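/- Let $P\subset\mathbb R^n$ be a rational convex polyhedron, i.e. the solution set of finitely many inequalities $\sum_i a_ix_i\le b$ with $a_i,b\in\mathbb Z$ (it may be empty or unbounded and may contain lines). Let $R$ be a commutative ring, let $\mathcal F_P$ be the set of nonempty faces of $P$ (including $P$ itself when $P\neq\varnothing$), and let $\varphi:\mathcal F_P\to R$ be any map. For $x\in P$ put $g(x)=\varphi(f)$, where $f$ is the smallest face of $P$ containing $x$, and let $$S_\varphi(P)=\sum_{a\in P\cap\mathbb Z^n}g(a)\,x_1^{a_1}\cdots x_n^{a_n}\in R[[x_1^{\pm1},\dots,x_n^{\pm1}]].$$ Then there is a $Q\in R[x_1^{\pm1},\dots,x_n^{\pm1}]$ that is not a zero divisor and for which $QS_\varphi(P)\in R[x_1^{\pm1},\dots,x_n^{\pm1}]$. Let $R(x_1,\dots,x_n)$ be the total ring of fractions of $R[x_1^{\pm1},\dots,x_n^{\pm1}]$, and let $\sigma_\varphi(P)=\frac{QS_\varphi(P)}{Q}\in R(x_1,\dots,x_n)$, which does not depend on the choice of $Q$. For a vertex $v$ of $P$ let $C_v=\{x : v+\varepsilon(x-v)\in P\text{ for some }\varepsilon>0\}$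 be the tangent cone to $P$ at $v$, again a rational polyhedron; the map $f\mapsto f\cap P$ embeds $\mathcal F_{C_v}$ into $\mathcal F_P$, and $\varphi$ also denotes the composition of $\varphi$ with this embedding, so that $\sigma_\varphi(C_v)$ is defined in the same way. Then $$\sigma_\varphi(P)=\sum_{v\text{ vertex of }P}\sigma_\varphi(C_v)\quad\text{in }R(x_1,\dots,x_n).$$ -/

import Mathlib

open scoped Topology

/-- The linear functional `x ↦ ∑ i, a i * x i` on `ℝⁿ` with integer coefficients. -/
noncomputable def intFunctional {n : ℕ} (a : Fin n → ℤ) : StrongDual ℝ (Fin n → ℝ) :=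
  ∑ i, (a i : ℝ) • ContinuousLinearMap.proj i

lemma intFunctional_apply {n : ℕ} (a : Fin n → ℤ) (x : Fin n → ℝ) :
    intFunctional a x = ∑ i, (a i : ℝ) * x i := by
  simp [intFunctional]

/-- The solution set in `ℝⁿ` of finitely many non-strict linear inequalities
`∑ i, a i * x i ≤ b`, given as pairs `(a, b)`, with integer coefficients. -/
def solutionSet {n : ℕ} (s : Finset ((Fin n → ℤ) × ℤ)) : Set (Fin n → ℝ) :=
  {x | ∀ p ∈ s, ∑ i, (p.1 i : ℝ) * x i ≤ (p.2 : ℝ)}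

lemma mem_solutionSet {n : ℕ} {s : Finset ((Fin n → ℤ) × ℤ)} {x : Fin n → ℝ} :
    x ∈ solutionSet s ↔ ∀ p ∈ s, intFunctional p.1 x ≤ (p.2 : ℝ) := by
  simp [solutionSet, intFunctional_apply]

/-- From a point `x` of a polyhedron one can move a little in the direction of `y` as soon as
the inequalities that are equalities at `x` hold at `y`. -/
lemma exists_pos_add_smul_mem {n : ℕ} {s : Finset ((Fin n → ℤ) × ℤ)} {x y : Fin n → ℝ}
    (hx : x ∈ solutionSet s)
    (hy : ∀ p ∈ s, intFunctional p.1 x = (p.2 : ℝ) → intFunctional p.1 y ≤ (p.2 : ℝ)) :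
    ∃ ε : ℝ, 0 < ε ∧ x + ε • (y - x) ∈ solutionSet s := by
  have hx' := mem_solutionSet.1 hx
  have key : ∀ᶠ ε : ℝ in 𝓝[>] 0, ∀ p ∈ s,
      intFunctional p.1 (x + ε • (y - x)) ≤ (p.2 : ℝ) := by
    rw [Filter.eventually_all_finset]
    intro p hp
    rcases (hx' p hp).eq_or_lt with h | h
    · filter_upwards [self_mem_nhdsWithin] with ε hε
      have hε' : (0 : ℝ) < ε := hε
      have := hy p hp h
      simp only [map_add, map_smul, map_sub, smul_eq_mul]
      nlinarith
    · have hc : Continuous fun ε : ℝ => intFunctional p.1 (x + ε • (y - x)) := by fun_prop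
      have h0 : intFunctional p.1 (x + (0 : ℝ) • (y - x)) < (p.2 : ℝ) := by simpa using h
      exact ((hc.continuousAt.eventually (gt_mem_nhds h0)).filter_mono nhdsWithin_le_nhds).mono
        fun _ h => le_of_lt h
  obtain ⟨ε, h, hε⟩ := (key.and self_mem_nhdsWithin).exists
  exact ⟨ε, hε, mem_solutionSet.2 h⟩

/-- A rational convex polyhedron in `ℝⁿ` (possibly empty, unbounded, or containing lines). -/
structure RationalPolyhedron (n : ℕ) where
  carrier : Set (Fin n → ℝ)
  exists_eq : ∃ s : Finset ((Fin n → ℤ) × ℤ), carrier = solutionSet s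

namespace RationalPolyhedron

/-- A (nonempty) face of `P`: the set of points of `P` at which some linear functional attains
its maximum over `P`. The zero functional gives `P` itself. -/
@[ext] structure Face {n : ℕ} (P : RationalPolyhedron n) where
  carrier : Set (Fin n → ℝ)
  nonempty : carrier.Nonempty
  isExposed : IsExposed ℝ P.carrier carrier

/-- The smallest face of `P` containing a given point `x` of `P`, i.e. the intersection of all
faces containing `x`. -/
def minFace {n : ℕ} (P : RationalPolyhedron n) (x : Fin n → ℝ) (hx : x ∈ P.carrier) :
    P.Face where
  carrier := {y | ∀ F : P.Face, x ∈ F.carrier → y ∈ F.carrier}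
  nonempty := ⟨x, fun _ h => h⟩
  isExposed := by
    classical
    obtain ⟨C, s, rfl⟩ := P
    intro _
    change x ∈ solutionSet s at hx
    have hx' := mem_solutionSet.1 hx
    set t := s.filter fun p => intFunctional p.1 x = (p.2 : ℝ) with ht
    set l : StrongDual ℝ (Fin n → ℝ) := ∑ p ∈ t, intFunctional p.1 with hl
    have hle : ∀ z ∈ solutionSet s, l z ≤ l x := by
      intro z hz
      simp only [hl, sum_apply]
      refine Finset.sum_le_sum fun p hp => ?_
      rw [(Finset.mem_filter.1 hp).2]
      exact mem_solutionSet.1 hz p (Finset.mem_filter.1 hp).1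
    refine ⟨l, Set.Subset.antisymm ?_ ?_⟩
    · intro y hy
      exact hy ⟨l.toExposed (solutionSet s), ⟨x, hx, hle⟩,
        ContinuousLinearMap.toExposed.isExposed⟩ ⟨hx, hle⟩
    · rintro y ⟨hy, hly⟩ F hxF
      have hy' := mem_solutionSet.1 hy
      have hlxy : l x = l y := le_antisymm (hly x hx) (hle y hy)
      have hact : ∀ p ∈ t, intFunctional p.1 y = intFunctional p.1 x := by
        simp only [hl, sum_apply] at hlxy
        refine (Finset.sum_eq_sum_iff_of_le fun p hp => ?_).1 hlxy.symm
        rw [(Finset.mem_filter.1 hp).2]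
        exact hy' p (Finset.mem_filter.1 hp).1
      obtain ⟨ε, hε, hmem⟩ := exists_pos_add_smul_mem (y := x + (x - y)) hx (by
        intro p hp h
        have := hact p (Finset.mem_filter.2 ⟨hp, h⟩)
        simp only [map_add, map_sub]
        linarith)
      obtain ⟨m, hm⟩ := F.isExposed F.nonempty
      rw [hm] at hxF ⊢
      have h1 := hxF.2 _ hmem
      simp only [map_add, map_sub, map_smul, smul_eq_mul] at h1
      have h2 : m x ≤ m y := by nlinarith
      exact ⟨hy, fun z hz => (hxF.2 z hz).trans h2⟩

/-- The set of vertices of `P`. -/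
def vertices {n : ℕ} (P : RationalPolyhedron n) : Set (Fin n → ℝ) :=
  P.carrier.extremePoints ℝ

lemma finite_vertices {n : ℕ} (P : RationalPolyhedron n) : P.vertices.Finite := by
  classical
  obtain ⟨C, s, rfl⟩ := P
  refine Set.Finite.of_injOn (f := fun x => s.filter fun p => intFunctional p.1 x = (p.2 : ℝ))
    (t := (s.powerset : Set (Finset ((Fin n → ℤ) × ℤ)))) ?_ ?_ (Finset.finite_toSet _)
  · intro x _
    exact Finset.mem_coe.2 (Finset.mem_powerset.2 (Finset.filter_subset _ _))
  · intro x hx y hy hxy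
    simp only at hxy
    have hx1 : x ∈ solutionSet s := hx.1
    have hy1 : y ∈ solutionSet s := hy.1
    obtain ⟨ε, hε, hmem⟩ := exists_pos_add_smul_mem (y := x + (x - y)) hx1 (by
      intro p hp h
      have h3 : p ∈ s.filter fun p => intFunctional p.1 y = (p.2 : ℝ) := by
        rw [← hxy]; exact Finset.mem_filter.2 ⟨hp, h⟩
      have := (Finset.mem_filter.1 h3).2
      simp only [map_add, map_sub]
      linarith)
    have := hx.2 hy1 hmem ⟨ε / (1 + ε), 1 / (1 + ε), by positivity, by positivity, by
      field_simp; ring, by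
      ext i
      simp only [Pi.add_apply, Pi.smul_apply, Pi.sub_apply, smul_eq_mul]
      field_simp
      ring⟩
    exact this.symm

noncomputable instance {n : ℕ} (P : RationalPolyhedron n) : Fintype P.vertices :=
  P.finite_vertices.fintype

/-- The tangent cone to `P` at a point `v` of `P`: the cone with apex `v` spanned by `P`. -/
def tangentCone {n : ℕ} (P : RationalPolyhedron n) (v : Fin n → ℝ) (hv : v ∈ P.carrier) :
    RationalPolyhedron n where
  carrier := {x | ∃ ε : ℝ, 0 < ε ∧ v + ε • (x - v) ∈ P.carrier}
  exists_eq := by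
    classical
    obtain ⟨C, s, rfl⟩ := P
    refine ⟨s.filter fun p => intFunctional p.1 v = (p.2 : ℝ), Set.Subset.antisymm ?_ ?_⟩
    · rintro x ⟨ε, hε, h⟩
      refine mem_solutionSet.2 fun p hp => ?_
      have h1 := mem_solutionSet.1 h p (Finset.mem_filter.1 hp).1
      have h2 := (Finset.mem_filter.1 hp).2
      simp only [map_add, map_sub, map_smul, smul_eq_mul] at h1
      nlinarith
    · intro x hx
      exact exists_pos_add_smul_mem hv fun p hp h =>
        mem_solutionSet.1 hx p (Finset.mem_filter.2 ⟨hp, h⟩)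

/-- The natural embedding of the faces of the tangent cone at `v` into the faces of `P`; its image
consists of the faces of `P` that contain `v`. -/
def Face.ofTangentCone {n : ℕ} {P : RationalPolyhedron n} {v : Fin n → ℝ} {hv : v ∈ P.carrier}
    (F : (P.tangentCone v hv).Face) : P.Face where
  carrier := F.carrier ∩ P.carrier
  nonempty := by
    refine ⟨v, ?_, hv⟩
    obtain ⟨m, hm⟩ := F.isExposed F.nonempty
    obtain ⟨x, hx⟩ := F.nonempty
    rw [hm] at hx ⊢
    obtain ⟨⟨ε, hε, hxε⟩, hmax⟩ := hx
    have hvC : v ∈ (P.tangentCone v hv).carrier := ⟨1, one_pos, by simpa using hv⟩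
    have hC : v + (2 : ℝ) • (x - v) ∈ (P.tangentCone v hv).carrier :=
      ⟨ε / 2, by positivity, by
        convert hxε using 2
        rw [add_sub_cancel_left, smul_smul, div_mul_cancel₀ _ two_ne_zero]⟩
    have h1 := hmax _ hC
    simp only [map_add, map_sub, map_smul, smul_eq_mul] at h1
    exact ⟨hvC, fun z hz => (hmax z hz).trans (by linarith)⟩
  isExposed := by
    rintro ⟨w, hwF, hwP⟩
    obtain ⟨m, hm⟩ := F.isExposed F.nonempty
    have hsub : P.carrier ⊆ (P.tangentCone v hv).carrier := fun x hx =>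
      ⟨1, one_pos, by simpa using hx⟩
    rw [hm] at hwF ⊢
    refine ⟨m, Set.Subset.antisymm ?_ ?_⟩
    · rintro x ⟨hx, hxP⟩
      exact ⟨hxP, fun z hz => hx.2 z (hsub hz)⟩
    · rintro x ⟨hxP, hx⟩
      exact ⟨⟨hsub hxP, fun z hz => (hwF.2 z hz).trans (hx w hwP)⟩, hxP⟩

/-- The coefficients of the weighted generating function `∑ g(a) e^a` over the lattice points `a`
of `P`, where `g(a)` is the value of `φ` at the minimal face containing `a`. -/
noncomputable def weightedSeries {n : ℕ} {R : Type*} [CommRing R] (P : RationalPolyhedron n)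
    (φ : P.Face → R) : (Fin n → ℤ) → R :=
  open Classical in
  fun a => if ha : (fun i => (a i : ℝ)) ∈ P.carrier then φ (P.minFace _ ha) else 0

end RationalPolyhedron

/-- Laurent polynomials over `R` in `n` variables; `AddMonoidAlgebra.single a 1` is the
monomial `x₁^(a₁) ⋯ xₙ^(aₙ)`. -/
abbrev LaurentPoly (n : ℕ) (R : Type*) [CommRing R] : Type _ :=
  AddMonoidAlgebra R (Fin n → ℤ)

/-- The product `q S` of a Laurent polynomial `q` and a formal Laurent series `S`, infinite in all
directions and given by its coefficients. -/
noncomputable def laurentMul {n : ℕ} {R : Type*} [CommRing R] (q : LaurentPoly n R)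
    (S : (Fin n → ℤ) → R) : (Fin n → ℤ) → R :=
  fun a => q.coeff.sum fun b r => r * S (a - b)

/-- `S` is the expansion of the fraction `N / Q`: `Q` is not a zero divisor and `Q S = N`. -/
def IsExpansion {n : ℕ} {R : Type*} [CommRing R] (S : (Fin n → ℤ) → R)
    (Q : nonZeroDivisors (LaurentPoly n R)) (N : LaurentPoly n R) : Prop :=
  laurentMul (Q : LaurentPoly n R) S = ⇑N.coeff

/-- Some Laurent polynomial that is not a zero divisor takes `S` to a Laurent polynomial. -/
def IsRationalSeries {n : ℕ} {R : Type*} [CommRing R] (S : (Fin n → ℤ) → R) : Prop :=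
  ∃ (Q : nonZeroDivisors (LaurentPoly n R)) (N : LaurentPoly n R), IsExpansion S Q N

/-- The rational function `Q S / Q`, in the total ring of fractions of the ring of Laurent
polynomials, given by a rational series `S` (and `0` if `S` is not rational). -/
noncomputable def rationalFunction {n : ℕ} {R : Type*} [CommRing R] (S : (Fin n → ℤ) → R) :
    FractionRing (LaurentPoly n R) :=
  open Classical in
  if h : IsRationalSeries S then
    IsLocalization.mk' (FractionRing (LaurentPoly n R)) h.choose_spec.choose h.choose
  else 0

lemma laurentMul_single {n : ℕ} {R : Type*} [CommRing R] (b : Fin n → ℤ) (r : R)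
    (S : (Fin n → ℤ) → R) (a : Fin n → ℤ) :
    laurentMul (AddMonoidAlgebra.single b r) S a = r * S (a - b) := by
  simp [laurentMul]

lemma laurentMul_add {n : ℕ} {R : Type*} [CommRing R] (p q : LaurentPoly n R)
    (S : (Fin n → ℤ) → R) : laurentMul (p + q) S = laurentMul p S + laurentMul q S := by
  classical
  funext a
  simp only [laurentMul, AddMonoidAlgebra.coeff_add, Pi.add_apply]
  exact Finsupp.sum_add_index' (by simp) (by intros; ring)

lemma laurentMul_zero {n : ℕ} {R : Type*} [CommRing R] (S : (Fin n → ℤ) → R) :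
    laurentMul (0 : LaurentPoly n R) S = 0 := by
  funext a
  simp [laurentMul]

lemma laurentMul_add_right {n : ℕ} {R : Type*} [CommRing R] (p : LaurentPoly n R)
    (S T : (Fin n → ℤ) → R) : laurentMul p (S + T) = laurentMul p S + laurentMul p T := by
  funext a
  simp [laurentMul, mul_add, Finsupp.sum_add]

lemma laurentMul_mul {n : ℕ} {R : Type*} [CommRing R] (p q : LaurentPoly n R)
    (S : (Fin n → ℤ) → R) : laurentMul (p * q) S = laurentMul p (laurentMul q S) := by
  induction p using AddMonoidAlgebra.induction_linear with
  | zero => simp [laurentMul_zero]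
  | add p p' hp hp' => rw [add_mul, laurentMul_add, hp, hp', laurentMul_add]
  | single b r =>
    induction q using AddMonoidAlgebra.induction_linear with
    | zero =>
      funext a
      simp [laurentMul_zero, laurentMul_single]
    | add q q' hq hq' =>
      rw [mul_add, laurentMul_add, hq, hq', laurentMul_add, laurentMul_add_right]
    | single c t =>
      funext a
      rw [AddMonoidAlgebra.single_mul_single]
      simp only [laurentMul_single]
      rw [sub_sub, mul_assoc]

lemma laurentMul_coeff {n : ℕ} {R : Type*} [CommRing R] (p q : LaurentPoly n R) :
    laurentMul p ⇑q.coeff = ⇑(p * q).coeff := by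
  induction p using AddMonoidAlgebra.induction_linear with
  | zero => simp [laurentMul_zero]
  | add p p' hp hp' => rw [add_mul, laurentMul_add, hp, hp']; rfl
  | single b r =>
    funext a
    rw [laurentMul_single, AddMonoidAlgebra.coeff_single_mul_apply]
    congr 2
    abel

/-- The rational function of a series does not depend on the choice of the denominator. -/
lemma rationalFunction_eq {n : ℕ} {R : Type*} [CommRing R] {S : (Fin n → ℤ) → R}
    {Q : nonZeroDivisors (LaurentPoly n R)} {N : LaurentPoly n R} (h : IsExpansion S Q N) :
    rationalFunction S = IsLocalization.mk' (FractionRing (LaurentPoly n R)) N Q := by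
  have hr : IsRationalSeries S := ⟨Q, N, h⟩
  have h' : IsExpansion S hr.choose hr.choose_spec.choose := hr.choose_spec.choose_spec
  rw [rationalFunction, dif_pos hr]
  apply IsLocalization.mk'_eq_of_eq
  apply AddMonoidAlgebra.coeff_injective
  apply DFunLike.coe_injective
  change laurentMul _ S = _ at h
  change laurentMul _ S = _ at h'
  rw [← laurentMul_coeff, ← laurentMul_coeff, ← h, ← h', ← laurentMul_mul, ← laurentMul_mul,
    mul_comm]

/-- The weighted integer point transform of `P`. -/
noncomputable def RationalPolyhedron.weightedIPT {n : ℕ} {R : Type*} [CommRing R]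
    (P : RationalPolyhedron n) (φ : P.Face → R) : FractionRing (LaurentPoly n R) :=
  rationalFunction (P.weightedSeries φ)

/-! ### Formal series that represent rational functions -/

section Series

variable {n : ℕ} {R : Type*} [CommRing R]

/-! The weight `g` depends only on the signs of the affine forms that define `P`. The formula is
therefore generalised to an arbitrary weight `ψ` on the sign patterns of finitely many affine forms,
with the sum over vertices replaced by a sum over all points `v` of the germ of the weight at `v`,
extended along rays (`IsBrion`). In this form the claim is linear in `ψ`, and every `ψ` is a
combination of products of functions of one sign each.

For products, `isBrion_prod` is an induction on the set of forms involved. If their linear parts are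
independent without common kernel, the forms are affine coordinates. The germ at their common zero
is the whole weight; any other germ ignores one of the forms, hence is periodic and represents 0. A
common kernel makes everything periodic. If the linear parts are dependent, the relation makes some
sign combinations impossible, which reduces the product to products over fewer forms.

For the weight of `P`, the germ at a vertex gives the series of the tangent cone
(`germSeries_patternWeight`), and the other germs represent 0
(`hasRationalFunction_germSeries_of_notMem_vertices`). -/

lemma laurentMul_one_sub_single (u : Fin n → ℤ) (S : (Fin n → ℤ) → R) (c : Fin n → ℤ) :
    laurentMul (1 - AddMonoidAlgebra.single u 1) S c = S c - S (c - u) := by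
  have h : (1 - AddMonoidAlgebra.single u 1 : LaurentPoly n R)
      = AddMonoidAlgebra.single 0 1 + AddMonoidAlgebra.single u (-1) := by
    rw [sub_eq_add_neg, AddMonoidAlgebra.one_def, AddMonoidAlgebra.single_neg]
  rw [h, laurentMul_add, Pi.add_apply, laurentMul_single, laurentMul_single]
  simp [sub_eq_add_neg]

/-- The coefficients of an annihilated `p` are periodic under `u`, so finite support forces them to
vanish. -/
lemma one_sub_single_mem_nonZeroDivisors {u : Fin n → ℤ} (hu : u ≠ 0) :
    (1 - AddMonoidAlgebra.single u 1 : LaurentPoly n R) ∈ nonZeroDivisors (LaurentPoly n R) := by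
  rw [mem_nonZeroDivisors_iff_right]
  intro p hp
  have hper : ∀ c, p.coeff (c - u) = p.coeff c := by
    intro c
    have h := congrFun (laurentMul_coeff (1 - AddMonoidAlgebra.single u 1) p) c
    rw [mul_comm, hp, laurentMul_one_sub_single] at h
    exact (sub_eq_zero.1 (h.trans (by simp))).symm
  apply AddMonoidAlgebra.coeff_injective
  ext c
  by_contra hc
  have hk : ∀ k : ℕ, p.coeff (c - k • u) = p.coeff c := by
    intro k
    induction k with
    | zero => simp
    | succ k ih => rw [add_smul, one_smul, ← sub_sub, hper, ih]
  refine Set.infinite_of_injective_forall_mem (f := fun k : ℕ => c - k • u) ?_ ?_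
    p.coeff.hasFiniteSupport
  · intro k l hkl
    obtain ⟨i, hi⟩ := Function.ne_iff.1 hu
    have := congrFun hkl i
    simpa [Pi.zero_apply] using (by simpa using this : (k : ℤ) = l ∨ u i = 0).resolve_right hi
  · intro k
    rw [Function.mem_support, hk k]
    exact hc

/-- The formal series `S` is rational and represents `q`. -/
def HasRationalFunction (S : (Fin n → ℤ) → R) (q : FractionRing (LaurentPoly n R)) : Prop :=
  ∃ (Q : nonZeroDivisors (LaurentPoly n R)) (N : LaurentPoly n R),
    IsExpansion S Q N ∧ IsLocalization.mk' (FractionRing (LaurentPoly n R)) N Q = q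

namespace HasRationalFunction

variable {S T : (Fin n → ℤ) → R} {p q : FractionRing (LaurentPoly n R)}

lemma isRationalSeries (h : HasRationalFunction S q) : IsRationalSeries S :=
  let ⟨Q, N, h, _⟩ := h
  ⟨Q, N, h⟩

lemma rationalFunction_eq (h : HasRationalFunction S q) : rationalFunction S = q := by
  obtain ⟨Q, N, h, rfl⟩ := h
  exact _root_.rationalFunction_eq h

lemma unique (hp : HasRationalFunction S p) (hq : HasRationalFunction S q) : p = q :=
  hp.rationalFunction_eq.symm.trans hq.rationalFunction_eq

lemma add (hp : HasRationalFunction S p) (hq : HasRationalFunction T q) :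
    HasRationalFunction (S + T) (p + q) := by
  obtain ⟨Q, N, h, rfl⟩ := hp
  obtain ⟨Q', N', h', rfl⟩ := hq
  refine ⟨Q * Q', N * Q' + N' * Q, ?_, IsLocalization.mk'_add _ _ _ _⟩
  unfold IsExpansion at h h' ⊢
  rw [Submonoid.coe_mul, laurentMul_add_right, laurentMul_mul _ _ T, h',
    mul_comm (Q : LaurentPoly n R) Q', laurentMul_mul, h, laurentMul_coeff, laurentMul_coeff,
    mul_comm N, mul_comm N', AddMonoidAlgebra.coeff_add, Finsupp.coe_add]

lemma smul (r : R) (hp : HasRationalFunction S p) :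
    HasRationalFunction (r • S)
      (algebraMap (LaurentPoly n R) _ (AddMonoidAlgebra.single 0 r) * p) := by
  obtain ⟨Q, N, h, rfl⟩ := hp
  refine ⟨Q, AddMonoidAlgebra.single 0 r * N, ?_, (IsLocalization.mul_mk'_eq_mk'_of_mul _ _ _).symm⟩
  unfold IsExpansion at h ⊢
  have hr : r • S = laurentMul (AddMonoidAlgebra.single 0 r) S := by
    funext c
    simp [laurentMul_single]
  rw [hr, ← laurentMul_mul, mul_comm, laurentMul_mul, h, laurentMul_coeff]

/-- The factor `1 - x ^ u` annihilates such a series and is not a zero divisor. This is the only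
source of cancellation in the whole argument. -/
lemma zero_of_periodic {u : Fin n → ℤ} (hu : u ≠ 0) (hS : ∀ c, S (c - u) = S c) :
    HasRationalFunction S 0 := by
  refine ⟨⟨_, one_sub_single_mem_nonZeroDivisors hu⟩, 0, ?_, IsLocalization.mk'_zero _⟩
  funext c
  simp [laurentMul_one_sub_single, hS]

end HasRationalFunction

lemma hasRationalFunction_zero : HasRationalFunction (0 : (Fin n → ℤ) → R) 0 := by
  refine ⟨1, 0, ?_, IsLocalization.mk'_zero _⟩
  funext c
  simp [laurentMul]

lemma IsRationalSeries.hasRationalFunction {S : (Fin n → ℤ) → R} (h : IsRationalSeries S) :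
    HasRationalFunction S (rationalFunction S) := by
  obtain ⟨Q, N, h⟩ := h
  exact ⟨Q, N, h, (rationalFunction_eq h).symm⟩

lemma isRationalSeries_of_finite_support {S : (Fin n → ℤ) → R}
    (Q : nonZeroDivisors (LaurentPoly n R))
    (h : (Function.support (laurentMul (Q : LaurentPoly n R) S)).Finite) :
    IsRationalSeries S :=
  ⟨Q, .ofCoeff (Finsupp.ofSupportFinite _ h), rfl⟩

open Classical in
/-- If multiplication by `1 - x ^ u i` only affects the `i`-th factor of a product series and turns
it into a function with finite support, then the series is rational. -/
lemma isRationalSeries_prod {ι : Type*} (s : Finset ι) (a u : ι → Fin n → ℤ) (g : ι → ℤ → R)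
    (hu : ∀ i ∈ s, u i ≠ 0) (hau : ∀ i ∈ s, ∀ j ∈ s, i ≠ j → a i ⬝ᵥ u j = 0)
    (hg : ∀ i ∈ s, (Function.support fun z => g i z - g i (z - a i ⬝ᵥ u i)).Finite)
    (hker : ∀ c : Fin n → ℤ, (∀ i ∈ s, a i ⬝ᵥ c = 0) → c = 0) :
    IsRationalSeries fun c => ∏ i ∈ s, g i (a i ⬝ᵥ c) := by
  set d : ι → ℤ → R := fun i z => g i z - g i (z - a i ⬝ᵥ u i) with hd
  have key : ∀ t ⊆ s, laurentMul (∏ i ∈ t, (1 - AddMonoidAlgebra.single (u i) 1))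
      (fun c => ∏ i ∈ s, g i (a i ⬝ᵥ c)) =
      fun c => ∏ i ∈ s, (if i ∈ t then d i else g i) (a i ⬝ᵥ c) := by
    intro t
    induction t using Finset.induction_on with
    | empty =>
      intro _
      funext c
      simp [AddMonoidAlgebra.one_def, laurentMul_single]
    | insert j t hj ih =>
      intro hts
      have hjs : j ∈ s := hts (Finset.mem_insert_self _ _)
      rw [Finset.prod_insert hj, laurentMul_mul,
        ih fun i hi => hts (Finset.mem_insert_of_mem hi)]
      funext c
      rw [laurentMul_one_sub_single, ← Finset.mul_prod_erase _ _ hjs,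
        ← Finset.mul_prod_erase _ _ hjs, ← Finset.mul_prod_erase _ _ hjs]
      have h1 : ∏ i ∈ s.erase j, (if i ∈ t then d i else g i) (a i ⬝ᵥ (c - u j)) =
          ∏ i ∈ s.erase j, (if i ∈ t then d i else g i) (a i ⬝ᵥ c) :=
        Finset.prod_congr rfl fun i hi => by
          rw [dotProduct_sub, hau i (Finset.mem_of_mem_erase hi) j hjs (Finset.ne_of_mem_erase hi),
            sub_zero]
      have h2 : ∏ i ∈ s.erase j, (if i ∈ insert j t then d i else g i) (a i ⬝ᵥ c) =
          ∏ i ∈ s.erase j, (if i ∈ t then d i else g i) (a i ⬝ᵥ c) :=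
        Finset.prod_congr rfl fun i hi => by
          simp [Finset.mem_insert, Finset.ne_of_mem_erase hi]
      rw [h1, h2, if_neg hj, if_pos (Finset.mem_insert_self _ _), dotProduct_sub]
      simp only [hd]
      ring
  refine isRationalSeries_of_finite_support ⟨∏ i ∈ s, (1 - AddMonoidAlgebra.single (u i) 1),
    prod_mem fun i hi => one_sub_single_mem_nonZeroDivisors (hu i hi)⟩ ?_
  rw [key s subset_rfl]
  have hfin : (Set.univ.pi fun i : s => Function.support (d i.1)).Finite :=
    Set.Finite.pi fun i => hg i.1 i.2
  -- The values `a i ⬝ᵥ c` determine `c` by `hker`, and each must lie in the finite support of `d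
  -- i`.
  refine Set.Finite.of_injOn (f := fun c (i : s) => a i.1 ⬝ᵥ c) ?_ ?_ hfin
  · intro c hc i _
    have hc' : ∏ i ∈ s, (if i ∈ s then d i else g i) (a i ⬝ᵥ c) ≠ 0 := hc
    intro h0
    exact hc' (Finset.prod_eq_zero i.2 (by rwa [if_pos i.2]))
  · intro c _ c' _ h
    refine sub_eq_zero.1 (hker _ fun i hi => ?_)
    rw [dotProduct_sub, sub_eq_zero]
    exact congrFun h ⟨i, hi⟩

end Series

/-! ### Integer vectors orthogonal to integer forms -/

lemma intFunctional_intCast {n : ℕ} (a c : Fin n → ℤ) :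
    intFunctional a (fun i => (c i : ℝ)) = ((a ⬝ᵥ c : ℤ) : ℝ) := by
  simp [intFunctional_apply, dotProduct]

/-- A finite family of integer vectors orthogonal to a nonzero real vector is orthogonal to a
nonzero integer vector. -/
lemma exists_int_dotProduct_eq_zero {n : ℕ} {ι : Type*} (s : Finset ι) (a : ι → Fin n → ℤ)
    {x : Fin n → ℝ} (hx : x ≠ 0) (h : ∀ i ∈ s, intFunctional (a i) x = 0) :
    ∃ u : Fin n → ℤ, u ≠ 0 ∧ ∀ i ∈ s, a i ⬝ᵥ u = 0 := by
  let A : Matrix s (Fin n) ℤ := Matrix.of fun i => a i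
  have hAx : (A.map (Int.castRingHom ℝ)).mulVec x = 0 := by
    funext i
    simpa [A, Matrix.mulVec, dotProduct, intFunctional_apply] using h i i.2
  -- The Gram matrix kills `x`, so it is singular over `ℝ`; its determinant is an integer, so it is
  -- singular over `ℤ` too.
  have hdet : (A.transpose * A).det = 0 := by
    have h1 : ((A.transpose * A).map (Int.castRingHom ℝ)).det = 0 :=
      Matrix.exists_mulVec_eq_zero_iff.1 ⟨x, hx, by
        rw [Matrix.map_mul, ← Matrix.mulVec_mulVec, hAx, Matrix.mulVec_zero]⟩
    rw [← RingHom.mapMatrix_apply, ← RingHom.map_det] at h1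
    exact Int.cast_eq_zero.1 h1
  obtain ⟨u, hu, hAu⟩ := Matrix.exists_mulVec_eq_zero_iff.2 hdet
  refine ⟨u, hu, fun i hi => ?_⟩
  have h2 : A.mulVec u ⬝ᵥ A.mulVec u = 0 := by
    rw [Matrix.dotProduct_mulVec, Matrix.vecMul_mulVec, ← Matrix.dotProduct_mulVec, hAu,
      dotProduct_zero]
  exact congrFun (dotProduct_self_eq_zero.1 h2) ⟨i, hi⟩

/-! ### Sign patterns of affine forms -/

section SignPattern

variable {n : ℕ} {ι : Type*} (a : ι → Fin n → ℤ) (b : ι → ℤ)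

/-- The signs at `x` of the affine forms `∑ k, a i k * x k - b i`. -/
noncomputable def signPattern (x : Fin n → ℝ) (i : ι) : SignType :=
  SignType.sign (intFunctional (a i) x - (b i : ℝ))

/-- The composition of two sign patterns: the second one decides where the first one is zero. -/
def signComp (σ τ : ι → SignType) (i : ι) : SignType :=
  if σ i = 0 then τ i else σ i

variable {a b}

lemma signPattern_eq_zero_iff {x : Fin n → ℝ} {i : ι} :
    signPattern a b x i = 0 ↔ intFunctional (a i) x = b i := by
  rw [signPattern, sign_eq_zero_iff, sub_eq_zero]

lemma signPattern_sub_intCast {u : Fin n → ℤ} {i : ι} (hu : a i ⬝ᵥ u = 0) (c : Fin n → ℤ) :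
    signPattern a b (fun k => ((c - u) k : ℝ)) i = signPattern a b (fun k => (c k : ℝ)) i := by
  rw [signPattern, signPattern, intFunctional_intCast, intFunctional_intCast, dotProduct_sub, hu,
    sub_zero]

/-- Near `v`, the sign pattern along the ray from `v` through `x` is the composition of the sign
patterns at `v` and at `x`. -/
lemma eventually_signPattern_eq_signComp [Finite ι] (v x : Fin n → ℝ) :
    ∀ᶠ ε : ℝ in 𝓝[>] 0, signPattern a b (v + ε • (x - v)) =
      signComp (signPattern a b v) (signPattern a b x) := by
  simp only [funext_iff]
  rw [Filter.eventually_all]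
  intro i
  have hlin : ∀ ε : ℝ, intFunctional (a i) (v + ε • (x - v)) - b i =
      intFunctional (a i) v - b i + ε * (intFunctional (a i) x - intFunctional (a i) v) := by
    intro ε
    simp only [map_add, map_smul, map_sub, smul_eq_mul]
    ring
  have hc : ContinuousAt (fun ε : ℝ => intFunctional (a i) (v + ε • (x - v)) - b i) 0 := by
    fun_prop
  simp only [signComp]
  split_ifs with h
  · filter_upwards [self_mem_nhdsWithin] with ε hε
    have hε' : (0 : ℝ) < ε := hε
    rw [signPattern_eq_zero_iff] at h
    rw [signPattern, hlin, h, sub_self, zero_add, sign_mul, sign_pos hε', one_mul, signPattern]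
  · rw [signPattern_eq_zero_iff, ← sub_eq_zero] at h
    refine Filter.Eventually.filter_mono nhdsWithin_le_nhds ?_
    rcases lt_or_gt_of_ne h with h | h
    · have h0 : (fun ε : ℝ => intFunctional (a i) (v + ε • (x - v)) - b i) 0 < 0 := by simpa using h
      filter_upwards [hc.eventually (gt_mem_nhds h0)] with ε hε
      rw [signPattern, signPattern, sign_neg hε, sign_neg h]
    · have h0 : 0 < (fun ε : ℝ => intFunctional (a i) (v + ε • (x - v)) - b i) 0 := by simpa using h
      filter_upwards [hc.eventually (lt_mem_nhds h0)] with ε hε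
      rw [signPattern, signPattern, sign_pos hε, sign_pos h]

lemma exists_signPattern_eq_signComp [Finite ι] (v x : Fin n → ℝ) :
    ∃ y, signPattern a b y = signComp (signPattern a b v) (signPattern a b x) :=
  let ⟨_, h⟩ := (eventually_signPattern_eq_signComp (a := a) (b := b) v x).exists
  ⟨_, h⟩

end SignPattern

/-! ### Brion's formula for weights on sign patterns -/

section Brion

variable {n : ℕ} {ι : Type*} {R : Type*} [CommRing R]

/-- The series of the weight on lattice points that depends on the sign pattern through `ψ`. -/
noncomputable def patternSeries (a : ι → Fin n → ℤ) (b : ι → ℤ) (ψ : (ι → SignType) → R) :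
    (Fin n → ℤ) → R :=
  fun c => ψ (signPattern a b fun k => (c k : ℝ))

/-- The series of the germ at `v` of the weight given by `ψ`, extended along rays from `v`. -/
noncomputable def germSeries (a : ι → Fin n → ℤ) (b : ι → ℤ) (v : Fin n → ℝ)
    (ψ : (ι → SignType) → R) : (Fin n → ℤ) → R :=
  patternSeries a b fun τ => ψ (signComp (signPattern a b v) τ)

/-- All germs of the weight given by `ψ` have rational series, only finitely many of them represent
nonzero rational functions, and these add up to that of the weight itself. -/
def IsBrion (a : ι → Fin n → ℤ) (b : ι → ℤ) (ψ : (ι → SignType) → R) : Prop :=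
  ∃ q : (Fin n → ℝ) →₀ FractionRing (LaurentPoly n R),
    (∀ v, HasRationalFunction (germSeries a b v ψ) (q v)) ∧
      HasRationalFunction (patternSeries a b ψ) (q.sum fun _ r => r)

variable {a : ι → Fin n → ℤ} {b : ι → ℤ} {ψ ψ' : (ι → SignType) → R}

namespace IsBrion

lemma zero : IsBrion a b (0 : (ι → SignType) → R) :=
  ⟨0, fun _ => hasRationalFunction_zero, hasRationalFunction_zero⟩

lemma add (h : IsBrion a b ψ) (h' : IsBrion a b ψ') : IsBrion a b (ψ + ψ') := by
  classical
  obtain ⟨q, hq, hs⟩ := h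
  obtain ⟨q', hq', hs'⟩ := h'
  refine ⟨q + q', fun v => (hq v).add (hq' v), ?_⟩
  rw [Finsupp.sum_add_index' (fun _ => rfl) fun _ _ _ => rfl]
  exact hs.add hs'

lemma smul (r : R) (h : IsBrion a b ψ) : IsBrion a b (r • ψ) := by
  obtain ⟨q, hq, hs⟩ := h
  set t := algebraMap (LaurentPoly n R) (FractionRing (LaurentPoly n R))
    (AddMonoidAlgebra.single 0 r)
  refine ⟨q.mapRange (t * ·) (mul_zero t), fun v => (hq v).smul r, ?_⟩
  rw [Finsupp.sum_mapRange_index fun _ => rfl, ← Finsupp.mul_sum]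
  exact hs.smul r

lemma sum {κ : Type*} (s : Finset κ) {ψ : κ → (ι → SignType) → R}
    (h : ∀ k ∈ s, IsBrion a b (ψ k)) : IsBrion a b (∑ k ∈ s, ψ k) :=
  Finset.sum_induction _ _ (fun _ _ => add) zero h

/-- Only patterns that occur at real points matter, even for germs, because the composition of two
occurring patterns occurs again. -/
lemma congr [Finite ι] (h : IsBrion a b ψ')
    (hψ : ∀ x, ψ (signPattern a b x) = ψ' (signPattern a b x)) : IsBrion a b ψ := by
  obtain ⟨q, hq, hs⟩ := h
  refine ⟨q, fun v => ?_, ?_⟩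
  · convert hq v using 1
    funext c
    obtain ⟨y, hy⟩ := exists_signPattern_eq_signComp (a := a) (b := b) v fun k => (c k : ℝ)
    simp only [germSeries, patternSeries, ← hy, hψ]
  · convert hs using 1
    funext c
    exact hψ _

end IsBrion

-- The end of the expansion along a relation. If some factor demands a negative term, the sum would
-- be negative wherever the product is nonzero, against `hκ`. If all factors in `t` demand zero,
-- then for `κ = 0` one equation follows from the others and its factor can be dropped; for `κ > 0`
-- the equations are inconsistent.
open Classical in
lemma isBrion_prod_of_all_zero_or_neg [Finite ι] {s t : Finset ι} (hts : t ⊆ s) (ht : t.Nonempty)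
    {w : ι → ℝ} (hw : ∀ i ∈ t, w i ≠ 0) {κ : ℝ} (hκ : 0 ≤ κ)
    (hrel : ∀ x, ∑ i ∈ t, w i * (intFunctional (a i) x - b i) = κ)
    (ih : ∀ s' ⊂ s, ∀ f : ι → SignType → R, IsBrion a b fun τ => ∏ i ∈ s', f i (τ i))
    {f : ι → SignType → R}
    (hf : ∀ i ∈ t, (f i = fun ε => if ε = 0 then 1 else 0) ∨
      f i = fun ε => if SignType.sign (w i) * ε = -1 then 1 else 0) :
    IsBrion a b fun τ => ∏ i ∈ s, f i (τ i) := by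
  by_cases hneg : ∃ i ∈ t, f i = fun ε => if SignType.sign (w i) * ε = -1 then 1 else 0
  · obtain ⟨j, hj, hfj⟩ := hneg
    refine IsBrion.zero.congr fun x => ?_
    simp only [Pi.zero_apply]
    by_contra hne
    have hne' : ∀ i ∈ t, f i (signPattern a b x i) ≠ 0 := fun i hi h0 =>
      hne (Finset.prod_eq_zero (hts hi) h0)
    have hsign : ∀ i, SignType.sign (w i) * signPattern a b x i =
        SignType.sign (w i * (intFunctional (a i) x - b i)) := fun i => (sign_mul _ _).symm
    have hlt : ∑ i ∈ t, w i * (intFunctional (a i) x - b i) < ∑ i ∈ t, (0 : ℝ) := by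
      refine Finset.sum_lt_sum (fun i hi => ?_) ⟨j, hj, ?_⟩
      · have h := hne' i hi
        rcases hf i hi with h' | h'
        · rw [h'] at h
          have h0 : signPattern a b x i = 0 := by
            by_contra h0
            exact h (if_neg h0)
          rw [signPattern_eq_zero_iff] at h0
          rw [h0, sub_self, mul_zero]
        · simp only [h', hsign] at h
          by_contra h0
          refine h (if_neg fun h1 => h0 (sign_eq_neg_one_iff.1 h1).le)
      · have h := hne' j hj
        simp only [hfj, hsign] at h
        by_contra h0
        exact h (if_neg fun h1 => h0 (sign_eq_neg_one_iff.1 h1))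
    rw [hrel, Finset.sum_const_zero] at hlt
    exact hκ.not_gt hlt
  · have hf0 : ∀ i ∈ t, f i = fun ε => if ε = 0 then 1 else 0 := fun i hi =>
      (hf i hi).resolve_right fun h => hneg ⟨i, hi, h⟩
    obtain ⟨j, hj⟩ := ht
    by_cases hκ0 : κ = 0
    · refine (ih (s.erase j) (Finset.erase_ssubset (hts hj)) f).congr fun x => ?_
      rw [← Finset.mul_prod_erase _ _ (hts hj)]
      by_cases hx : ∀ i ∈ t.erase j, signPattern a b x i = 0
      · have hj0 : signPattern a b x j = 0 := by
          have h := hrel x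
          rw [← Finset.add_sum_erase _ _ hj, Finset.sum_eq_zero, add_zero, hκ0] at h
          · rw [signPattern_eq_zero_iff, ← sub_eq_zero]
            exact (mul_eq_zero.1 h).resolve_left (hw j hj)
          · intro i hi
            rw [signPattern_eq_zero_iff.1 (hx i hi), sub_self, mul_zero]
        simp only [hf0 j hj, hj0, if_pos, one_mul]
      · push Not at hx
        obtain ⟨i, hi, hi0⟩ := hx
        rw [Finset.prod_eq_zero (i := i), mul_zero]
        · exact Finset.mem_erase.2 ⟨(Finset.mem_erase.1 hi).1, hts (Finset.mem_erase.1 hi).2⟩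
        · simp only [hf0 i (Finset.mem_erase.1 hi).2, if_neg hi0]
    · refine IsBrion.zero.congr fun x => ?_
      obtain ⟨i, hi, hi0⟩ : ∃ i ∈ t, signPattern a b x i ≠ 0 := by
        by_contra! h
        refine hκ0 ((hrel x).symm.trans (Finset.sum_eq_zero fun i hi => ?_))
        rw [signPattern_eq_zero_iff.1 (h i hi), sub_self, mul_zero]
      exact Finset.prod_eq_zero (hts hi) (by simp only [hf0 i hi, if_neg hi0])

-- A function of a sign is a combination of 1, the indicator of 0 and the indicator of the sign
-- opposite to `w i`. The constant removes the factor, so `ih` applies; the indicators lead to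
-- `isBrion_prod_of_all_zero_or_neg`.
open Classical in
lemma isBrion_prod_of_relation [Finite ι] {s t : Finset ι} (hts : t ⊆ s) (ht : t.Nonempty)
    {w : ι → ℝ} (hw : ∀ i ∈ t, w i ≠ 0) {κ : ℝ} (hκ : 0 ≤ κ)
    (hrel : ∀ x, ∑ i ∈ t, w i * (intFunctional (a i) x - b i) = κ)
    (ih : ∀ s' ⊂ s, ∀ f : ι → SignType → R, IsBrion a b fun τ => ∏ i ∈ s', f i (τ i))
    (f : ι → SignType → R) : IsBrion a b fun τ => ∏ i ∈ s, f i (τ i) := by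
  -- The indices of `t` whose factors are still arbitrary form `t'`.
  suffices h : ∀ t' ⊆ t, ∀ f : ι → SignType → R,
      (∀ i ∈ t, i ∉ t' → (f i = fun ε => if ε = 0 then 1 else 0) ∨
        f i = fun ε => if SignType.sign (w i) * ε = -1 then 1 else 0) →
      IsBrion a b fun τ => ∏ i ∈ s, f i (τ i) from
    h t subset_rfl f fun i hi hi' => absurd hi hi'
  intro t'
  induction t' using Finset.induction_on with
  | empty =>
    intro _ f hf
    exact isBrion_prod_of_all_zero_or_neg hts ht hw hκ hrel ih fun i hi =>
      hf i hi (Finset.notMem_empty i)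
  | insert j t' hj ih' =>
    intro ht' f hf
    have hjt : j ∈ t := ht' (Finset.mem_insert_self _ _)
    have ht'' : t' ⊆ t := fun i hi => ht' (Finset.mem_insert_of_mem hi)
    have hstep : ∀ g : SignType → R, ((g = fun ε => if ε = 0 then 1 else 0) ∨
        g = fun ε => if SignType.sign (w j) * ε = -1 then 1 else 0) →
        IsBrion a b fun τ => ∏ i ∈ s, Function.update f j g i (τ i) := by
      intro g hg
      refine ih' ht'' _ fun i hi hi' => ?_
      by_cases hij : i = j
      · subst hij
        rwa [Function.update_self]
      · rw [Function.update_of_ne hij]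
        exact hf i hi (by simp [hij, hi'])
    set σ := SignType.sign (w j) with hσ
    have hσ0 : σ ≠ 0 := by simpa [hσ] using hw j hjt
    refine ((((ih (s.erase j) (Finset.erase_ssubset (hts hjt)) f).smul (f j σ)).add
      ((hstep _ (.inl rfl)).smul (f j 0 - f j σ))).add
      ((hstep _ (.inr rfl)).smul (f j (-σ) - f j σ))).congr fun x => ?_
    have hupd : ∀ g : SignType → R, ∏ i ∈ s, Function.update f j g i (signPattern a b x i) =
        g (signPattern a b x j) * ∏ i ∈ s.erase j, f i (signPattern a b x i) := by
      intro g
      rw [← Finset.mul_prod_erase _ _ (hts hjt), Function.update_self]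
      congr 1
      refine Finset.prod_congr rfl fun i hi => ?_
      rw [Function.update_of_ne (Finset.ne_of_mem_erase hi)]
    simp only [Pi.add_apply, Pi.smul_apply, smul_eq_mul, hupd]
    rw [← Finset.mul_prod_erase _ _ (hts hjt)]
    -- The base value is taken at `σ`, the only sign at which both indicators vanish.
    have hexp : ∀ ε : SignType, f j ε = f j σ + (f j 0 - f j σ) * (if ε = 0 then 1 else 0) +
        (f j (-σ) - f j σ) * (if σ * ε = -1 then 1 else 0) := by
      clear_value σ
      intro ε
      rcases σ with _ | _ | _
      · exact absurd rfl hσ0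
      · rcases ε with _ | _ | _ <;> simp
      · rcases ε with _ | _ | _ <;> simp
    rw [hexp (signPattern a b x j)]
    ring

-- Integer directions `u j` orthogonal to all forms but the `j`-th give the denominator `∏ (1 - x ^
-- u j)`.
open Classical in
lemma isRationalSeries_patternSeries_prod (s : Finset ι)
    (hdual : ∀ j ∈ s, ∃ x, intFunctional (a j) x ≠ 0 ∧ ∀ i ∈ s, i ≠ j → intFunctional (a i) x = 0)
    (hker : ∀ x, (∀ i ∈ s, intFunctional (a i) x = 0) → x = 0) (f : ι → SignType → R) :
    IsRationalSeries (patternSeries a b fun τ => ∏ i ∈ s, f i (τ i)) := by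
  have hker' : ∀ c : Fin n → ℤ, (∀ i ∈ s, a i ⬝ᵥ c = 0) → c = 0 := by
    intro c hc
    have := hker (fun k => (c k : ℝ)) fun i hi => by
      rw [intFunctional_intCast, hc i hi, Int.cast_zero]
    funext k
    exact Int.cast_eq_zero.1 (congrFun this k)
  have hu : ∀ j, ∃ u : Fin n → ℤ, j ∈ s → u ≠ 0 ∧ ∀ i ∈ s, i ≠ j → a i ⬝ᵥ u = 0 := by
    intro j
    by_cases hj : j ∈ s
    · obtain ⟨x, hx, hx'⟩ := hdual j hj
      have hx0 : x ≠ 0 := by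
        rintro rfl
        exact hx (map_zero _)
      obtain ⟨u, hu, hu'⟩ := exists_int_dotProduct_eq_zero (s.erase j) a hx0 fun i hi =>
        hx' i (Finset.mem_of_mem_erase hi) (Finset.ne_of_mem_erase hi)
      exact ⟨u, fun _ => ⟨hu, fun i hi hij => hu' i (Finset.mem_erase.2 ⟨hij, hi⟩)⟩⟩
    · exact ⟨0, fun h => absurd h hj⟩
  choose u hu using hu
  have h := isRationalSeries_prod s a u (fun i z => f i (SignType.sign (z - b i)))
    (fun i hi => (hu i hi).1) (fun i hi j hj hij => (hu j hj).2 i hi hij) (fun i _ => ?_) hker'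
  · convert h using 1
    funext c
    simp only [patternSeries, signPattern, intFunctional_intCast]
    refine Finset.prod_congr rfl fun i _ => ?_
    rw [← Int.cast_sub]
    congr 1
    rcases lt_trichotomy (a i ⬝ᵥ c - b i) 0 with h | h | h
    · rw [sign_neg h, sign_neg (by exact_mod_cast h)]
    · simp [h]
    · rw [sign_pos h, sign_pos (by exact_mod_cast h)]
  -- Outside this interval `z` and `z - a i ⬝ᵥ u i` lie strictly on the same side of `b i`.
  · refine (Set.finite_Icc (b i - |a i ⬝ᵥ u i|) (b i + |a i ⬝ᵥ u i|)).subset fun z hz => ?_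
    by_contra hz'
    refine hz (sub_eq_zero.2 ?_)
    have h1 := le_abs_self (a i ⬝ᵥ u i)
    have h2 := neg_abs_le (a i ⬝ᵥ u i)
    rw [Set.mem_Icc, not_and_or, not_le, not_le] at hz'
    rcases hz' with hz' | hz'
    · rw [sign_neg (by linarith), sign_neg (by linarith)]
    · rw [sign_pos (by linarith), sign_pos (by linarith)]

open Classical in
lemma isBrion_prod_of_surjective {s : Finset ι}
    (hsurj : ∀ y : ι → ℝ, ∃ x, ∀ i ∈ s, intFunctional (a i) x = y i) (f : ι → SignType → R) :
    IsBrion a b fun τ => ∏ i ∈ s, f i (τ i) := by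
  by_cases hker : ∀ x, (∀ i ∈ s, intFunctional (a i) x = 0) → x = 0
  · have hdual : ∀ j ∈ s, ∃ x, intFunctional (a j) x ≠ 0 ∧
        ∀ i ∈ s, i ≠ j → intFunctional (a i) x = 0 := by
      intro j hj
      obtain ⟨x, hx⟩ := hsurj (Pi.single j 1)
      exact ⟨x, by simp [hx j hj], fun i hi hij => by simp [hx i hi, hij]⟩
    have hrat := (isRationalSeries_patternSeries_prod (b := b) s hdual hker f).hasRationalFunction
    -- The common zero of the forms in `s` carries the whole rational function.
    obtain ⟨v, hv⟩ := hsurj fun i => b i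
    refine ⟨Finsupp.single v (rationalFunction (patternSeries a b fun τ => ∏ i ∈ s, f i (τ i))),
      fun v' => ?_, ?_⟩
    rotate_left
    · rw [Finsupp.sum_single_index rfl]
      exact hrat
    · by_cases hvv : v = v'
      · subst hvv
        rw [Finsupp.single_eq_same]
        convert hrat using 1
        funext c
        refine Finset.prod_congr rfl fun i hi => ?_
        rw [signComp, if_pos (signPattern_eq_zero_iff.2 (hv i hi))]
      · rw [Finsupp.single_eq_of_ne' hvv]
        obtain ⟨j, hj, hj0⟩ : ∃ j ∈ s, signPattern a b v' j ≠ 0 := by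
          by_contra! h
          refine hvv (sub_eq_zero.1 (hker _ fun i hi => ?_))
          rw [map_sub, hv i hi, signPattern_eq_zero_iff.1 (h i hi), sub_self]
        obtain ⟨x, hx, hx'⟩ := hdual j hj
        have hx0 : x ≠ 0 := by
          rintro rfl
          exact hx (map_zero _)
        -- In the germ at `v'` the sign of form `j` is frozen, so a direction orthogonal to the
        -- other forms is a period.
        obtain ⟨u, hu, hu'⟩ := exists_int_dotProduct_eq_zero (s.erase j) a hx0 fun i hi =>
          hx' i (Finset.mem_of_mem_erase hi) (Finset.ne_of_mem_erase hi)
        refine .zero_of_periodic hu fun c => ?_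
        refine Finset.prod_congr rfl fun i hi => ?_
        by_cases hij : i = j
        · subst hij
          rw [signComp, signComp, if_neg hj0, if_neg hj0]
        · simp only [signComp]
          rw [signPattern_sub_intCast (hu' i (Finset.mem_erase.2 ⟨hij, hi⟩))]
  · push Not at hker
    obtain ⟨x, hx, hx0⟩ := hker
    obtain ⟨u, hu, hu'⟩ := exists_int_dotProduct_eq_zero s a hx0 hx
    refine ⟨0, fun v => .zero_of_periodic hu fun c => ?_, .zero_of_periodic hu fun c => ?_⟩
    · refine Finset.prod_congr rfl fun i hi => ?_
      simp only [signComp]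
      rw [signPattern_sub_intCast (hu' i hi)]
    · refine Finset.prod_congr rfl fun i hi => ?_
      rw [signPattern_sub_intCast (hu' i hi)]

open Classical in
lemma exists_surjective_or_relation (s : Finset ι) (a : ι → Fin n → ℤ) :
    (∀ y : ι → ℝ, ∃ x, ∀ i ∈ s, intFunctional (a i) x = y i) ∨
      ∃ w : ι → ℝ, (∃ i ∈ s, w i ≠ 0) ∧ ∀ x, ∑ i ∈ s, w i * intFunctional (a i) x = 0 := by
  let L : (Fin n → ℝ) →ₗ[ℝ] (s → ℝ) := LinearMap.pi fun i => (intFunctional (a i)).toLinearMap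
  by_cases hL : LinearMap.range L = ⊤
  · left
    intro y
    obtain ⟨x, hx⟩ := LinearMap.range_eq_top.1 hL fun i => y i
    exact ⟨x, fun i hi => congrFun hx ⟨i, hi⟩⟩
  · right
    -- A proper range lies in the kernel of a nonzero functional, whose coefficients are the
    -- relation.
    obtain ⟨g, hg, hLg⟩ := Submodule.exists_le_ker_of_lt_top _ (lt_top_iff_ne_top.2 hL)
    have hgy : ∀ y : s → ℝ, g y = ∑ i, y i * g (Pi.single i 1) := by
      intro y
      conv_lhs => rw [pi_eq_sum_univ' y]
      simp [map_sum]
    refine ⟨fun i => if hi : i ∈ s then g (Pi.single ⟨i, hi⟩ 1) else 0, ?_, fun x => ?_⟩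
    · by_contra! h
      refine hg (LinearMap.ext fun y => ?_)
      rw [hgy, LinearMap.zero_apply]
      refine Finset.sum_eq_zero fun i _ => ?_
      have := h i i.2
      rw [dif_pos i.2] at this
      rw [this, mul_zero]
    · have h : g (L x) = 0 := hLg ⟨x, rfl⟩
      rw [hgy] at h
      rw [← Finset.sum_coe_sort s, ← h]
      refine Finset.sum_congr rfl fun i _ => ?_
      simp only [dif_pos i.2]
      exact mul_comm _ _

open Classical in
lemma isBrion_prod [Finite ι] (s : Finset ι) (f : ι → SignType → R) :
    IsBrion a b fun τ => ∏ i ∈ s, f i (τ i) := by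
  induction s using Finset.strongInduction generalizing f with
  | H s ih =>
  rcases exists_surjective_or_relation s a with hsurj | ⟨w, ⟨j, hj, hwj⟩, hw⟩
  · exact isBrion_prod_of_surjective hsurj f
  · have hsum : ∀ g : ι → ℝ, ∑ i ∈ s with w i ≠ 0, w i * g i = ∑ i ∈ s, w i * g i := by
      intro g
      refine Finset.sum_filter_of_ne fun i _ h h0 => h (by rw [h0, zero_mul])
    have hne : (s.filter fun i => w i ≠ 0).Nonempty := ⟨j, Finset.mem_filter.2 ⟨hj, hwj⟩⟩
    have hrel : ∀ x, ∑ i ∈ s with w i ≠ 0, w i * (intFunctional (a i) x - b i) =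
        -∑ i ∈ s, w i * b i := by
      intro x
      rw [hsum]
      simp only [mul_sub, Finset.sum_sub_distrib, hw, zero_sub]
    -- Changing the sign of `w` if necessary makes the constant nonnegative.
    rcases le_total 0 (-∑ i ∈ s, w i * b i) with h | h
    · exact isBrion_prod_of_relation (Finset.filter_subset _ _) hne
        (fun i hi => (Finset.mem_filter.1 hi).2) h hrel ih f
    · refine isBrion_prod_of_relation (w := -w) (Finset.filter_subset _ _) hne
        (fun i hi => neg_ne_zero.2 (Finset.mem_filter.1 hi).2) (neg_nonneg.2 h)
        (fun x => ?_) ih f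
      rw [← hrel x, ← Finset.sum_neg_distrib]
      exact Finset.sum_congr rfl fun i _ => neg_mul _ _

/-- Brion's formula for weights that depend on the signs of finitely many affine forms. -/
theorem isBrion [Finite ι] (a : ι → Fin n → ℤ) (b : ι → ℤ) (ψ : (ι → SignType) → R) :
    IsBrion a b ψ := by
  classical
  cases nonempty_fintype ι
  -- The indicator of a single pattern is a product over the forms.
  have h : ψ = ∑ σ, ψ σ • fun τ => ∏ i, if τ i = σ i then 1 else 0 := by
    funext τ
    rw [Finset.sum_apply, Finset.sum_eq_single τ]
    · simp
    · intro σ _ hσ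
      obtain ⟨i, hi⟩ := Function.ne_iff.1 hσ
      rw [Pi.smul_apply, Finset.prod_eq_zero (Finset.mem_univ i) (if_neg hi.symm), smul_zero]
    · simp
  rw [h]
  exact IsBrion.sum _ fun σ _ =>
    (isBrion_prod Finset.univ fun i ε => if ε = σ i then 1 else 0).smul _

end Brion

/-! ### Faces and tangent cones of a polyhedron in terms of sign patterns -/

lemma mem_solutionSet_iff_signPattern {n : ℕ} {s : Finset ((Fin n → ℤ) × ℤ)} {x : Fin n → ℝ} :
    x ∈ solutionSet s ↔ ∀ p : s, signPattern (fun p : s => p.1.1) (fun p => p.1.2) x p ≠ 1 := by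
  rw [mem_solutionSet, Subtype.forall]
  refine forall₂_congr fun p hp => ?_
  rw [signPattern, ne_eq, sign_eq_one_iff, sub_pos, not_lt]

namespace RationalPolyhedron

variable {n : ℕ} {P : RationalPolyhedron n} {s : Finset ((Fin n → ℤ) × ℤ)}

/-- Each inequality active at `x` cuts out a face through `x`. Conversely, the segment from `y` to
`x` extends beyond `x` inside `P`, so a functional maximal at `x` is maximal at `y`. -/
lemma mem_minFace_iff (hs : P.carrier = solutionSet s) {x : Fin n → ℝ} (hx : x ∈ P.carrier)
    {y : Fin n → ℝ} : y ∈ (P.minFace x hx).carrier ↔ y ∈ P.carrier ∧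
      ∀ p ∈ s, intFunctional p.1 x = (p.2 : ℝ) → intFunctional p.1 y = (p.2 : ℝ) := by
  constructor
  · intro hy
    have hyP : y ∈ P.carrier :=
      (P.minFace x hx).isExposed.subset hy
    refine ⟨hyP, fun p hp hpx => ?_⟩
    have hle : ∀ z ∈ P.carrier, intFunctional p.1 z ≤ intFunctional p.1 x := by
      intro z hz
      rw [hpx]
      rw [hs] at hz
      exact mem_solutionSet.1 hz p hp
    have h := hy ⟨(intFunctional p.1).toExposed P.carrier, ⟨x, hx, hle⟩,
      ContinuousLinearMap.toExposed.isExposed⟩ ⟨hx, hle⟩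
    exact le_antisymm (hpx ▸ hle y hyP) (hpx ▸ h.2 x hx)
  · rintro ⟨hy, hact⟩ F hxF
    rw [hs] at hx
    obtain ⟨ε, hε, hmem⟩ := exists_pos_add_smul_mem (y := x + (x - y)) hx (by
      intro p hp h
      simp only [map_add, map_sub, hact p hp h, h]
      linarith)
    rw [← hs] at hmem
    obtain ⟨m, hm⟩ := F.isExposed F.nonempty
    rw [hm] at hxF ⊢
    have h1 := hxF.2 _ hmem
    simp only [map_add, map_sub, map_smul, smul_eq_mul] at h1
    have h2 : m x ≤ m y := by nlinarith
    exact ⟨hy, fun z hz => (hxF.2 z hz).trans h2⟩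

open Classical in
lemma tangentCone_carrier (hs : P.carrier = solutionSet s) {v : Fin n → ℝ} (hv : v ∈ P.carrier) :
    (P.tangentCone v hv).carrier =
      solutionSet (s.filter fun p => intFunctional p.1 v = (p.2 : ℝ)) := by
  ext x
  constructor
  · rintro ⟨ε, hε, h⟩
    rw [hs] at h
    refine mem_solutionSet.2 fun p hp => ?_
    have h1 := mem_solutionSet.1 h p (Finset.mem_filter.1 hp).1
    have h2 := (Finset.mem_filter.1 hp).2
    simp only [map_add, map_sub, map_smul, smul_eq_mul] at h1
    nlinarith
  · intro hx
    change ∃ ε : ℝ, 0 < ε ∧ v + ε • (x - v) ∈ P.carrier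
    rw [hs] at hv ⊢
    exact exists_pos_add_smul_mem hv fun p hp h =>
      mem_solutionSet.1 hx p (Finset.mem_filter.2 ⟨hp, h⟩)

lemma carrier_subset_tangentCone {v : Fin n → ℝ} (hv : v ∈ P.carrier) :
    P.carrier ⊆ (P.tangentCone v hv).carrier :=
  fun x hx => ⟨1, one_pos, by simpa using hx⟩

variable {R : Type*} [CommRing R]

open Classical in
/-- The weight given by `φ`, as a function of the signs of the defining affine forms of `P`. -/
noncomputable def patternWeight (P : RationalPolyhedron n) (s : Finset ((Fin n → ℤ) × ℤ))
    (φ : P.Face → R) (τ : s → SignType) : R :=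
  if h : ∃ x : P.carrier, signPattern (fun p : s => p.1.1) (fun p => p.1.2) x.1 = τ then
    φ (P.minFace h.choose.1 h.choose.2)
  else 0

open Classical in
lemma patternWeight_signPattern (hs : P.carrier = solutionSet s) (φ : P.Face → R)
    (x : Fin n → ℝ) :
    P.patternWeight s φ (signPattern (fun p : s => p.1.1) (fun p => p.1.2) x) =
      if hx : x ∈ P.carrier then φ (P.minFace x hx) else 0 := by
  rw [patternWeight]
  split_ifs with h hx hx
  -- The chosen point has the same active inequalities as `x`, and these determine the minimal face.
  · congr 1
    ext y
    rw [mem_minFace_iff hs, mem_minFace_iff hs]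
    refine and_congr_right fun _ => forall₂_congr fun p hp => ?_
    have := congrFun h.choose_spec ⟨p, hp⟩
    rw [← signPattern_eq_zero_iff (a := fun p : s => p.1.1) (b := fun p => p.1.2) (i := ⟨p, hp⟩),
      this, signPattern_eq_zero_iff]
  · obtain ⟨⟨y, hy⟩, hyx⟩ := h
    rw [hs, mem_solutionSet_iff_signPattern] at hx hy
    exact absurd (fun p => hyx ▸ hy p) hx
  · exact absurd ⟨⟨x, hx⟩, rfl⟩ h
  · rfl

lemma patternSeries_patternWeight (hs : P.carrier = solutionSet s) (φ : P.Face → R) :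
    patternSeries (fun p : s => p.1.1) (fun p => p.1.2) (P.patternWeight s φ) =
      P.weightedSeries φ :=
  funext fun _ => patternWeight_signPattern hs φ _

/-- For small `ε > 0`, the point `v + ε • (x - v)` lies in `P` exactly when `x` lies in the tangent
cone. The inequalities active there are those active at both `v` and `x`, so its minimal face is the
trace on `P` of the minimal face of `x` in the cone. -/
lemma germSeries_patternWeight (hs : P.carrier = solutionSet s) (φ : P.Face → R) {v : Fin n → ℝ}
    (hv : v ∈ P.carrier) :
    germSeries (fun p : s => p.1.1) (fun p => p.1.2) v (P.patternWeight s φ) =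
      (P.tangentCone v hv).weightedSeries fun F => φ F.ofTangentCone := by
  classical
  funext c
  set x : Fin n → ℝ := fun k => (c k : ℝ) with hx
  obtain ⟨ε, hy, hε⟩ := ((eventually_signPattern_eq_signComp (a := fun p : s => p.1.1)
    (b := fun p => p.1.2) v x).and self_mem_nhdsWithin).exists
  have hmem : v + ε • (x - v) ∈ P.carrier ↔ x ∈ (P.tangentCone v hv).carrier := by
    refine ⟨fun h => ⟨ε, hε, h⟩, fun h => ?_⟩
    rw [tangentCone_carrier hs, mem_solutionSet] at h
    rw [hs, mem_solutionSet_iff_signPattern] at hv ⊢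
    intro p
    rw [hy, signComp]
    split_ifs with h0
    · rw [signPattern, ne_eq, sign_eq_one_iff, sub_pos, not_lt]
      exact h p (Finset.mem_filter.2 ⟨p.2, signPattern_eq_zero_iff.1 h0⟩)
    · exact hv p
  simp only [germSeries, patternSeries, weightedSeries]
  rw [← hy, patternWeight_signPattern hs]
  by_cases hxC : x ∈ (P.tangentCone v hv).carrier
  · rw [dif_pos (hmem.2 hxC), dif_pos hxC]
    congr 1
    ext z
    change z ∈ _ ↔ z ∈ Face.carrier _ ∧ z ∈ P.carrier
    rw [mem_minFace_iff hs, mem_minFace_iff (tangentCone_carrier hs hv)]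
    have hact : ∀ p ∈ s, intFunctional p.1 (v + ε • (x - v)) = (p.2 : ℝ) ↔
        intFunctional p.1 v = (p.2 : ℝ) ∧ intFunctional p.1 x = (p.2 : ℝ) := by
      intro p hp
      have h := congrFun hy ⟨p, hp⟩
      have hiff : ∀ w, intFunctional p.1 w = (p.2 : ℝ) ↔
          signPattern (fun p : s => p.1.1) (fun p => p.1.2) w ⟨p, hp⟩ = 0 :=
        fun w => signPattern_eq_zero_iff.symm
      rw [hiff, hiff, hiff, h, signComp]
      split_ifs with h0 <;> simp [h0]
    constructor
    · rintro ⟨hz, h⟩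
      refine ⟨⟨carrier_subset_tangentCone hv hz, fun p hp hpx => ?_⟩, hz⟩
      rw [Finset.mem_filter] at hp
      exact h p hp.1 ((hact p hp.1).2 ⟨hp.2, hpx⟩)
    · rintro ⟨⟨_, h⟩, hz⟩
      refine ⟨hz, fun p hp hpy => ?_⟩
      rw [hact p hp] at hpy
      exact h p (Finset.mem_filter.2 ⟨hp, hpy.1⟩) hpy.2
  · rw [dif_neg fun h => hxC (hmem.1 h), dif_neg hxC]

/-- At a point of a polyhedron that is not a vertex, the active inequalities are orthogonal to some
nonzero integer vector. -/
lemma exists_int_dotProduct_eq_zero_of_notMem_vertices (hs : P.carrier = solutionSet s)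
    {v : Fin n → ℝ} (hv : v ∈ P.carrier) (hv' : v ∉ P.vertices) :
    ∃ u : Fin n → ℤ, u ≠ 0 ∧ ∀ p ∈ s, intFunctional p.1 v = (p.2 : ℝ) → p.1 ⬝ᵥ u = 0 := by
  classical
  rw [vertices, mem_extremePoints] at hv'
  push Not at hv'
  obtain ⟨x, hx, y, hy, ⟨α, β, hα, hβ, hαβ, hxy⟩, hne⟩ := hv' hv
  rw [hs, mem_solutionSet] at hx hy
  have hsub : x - y ≠ 0 := by
    rw [sub_ne_zero]
    rintro rfl
    rw [← add_smul, hαβ, one_smul] at hxy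
    exact hne hxy hxy
  obtain ⟨u, hu, hu'⟩ := exists_int_dotProduct_eq_zero
    (s.filter fun p => intFunctional p.1 v = (p.2 : ℝ)) (fun p => p.1) hsub (by
      intro p hp
      rw [Finset.mem_filter] at hp
      have h1 := hx p hp.1
      have h2 := hy p hp.1
      have h3 := hp.2
      rw [← hxy] at h3
      simp only [map_add, map_smul, smul_eq_mul] at h3
      rw [map_sub]
      have hβ' : β = 1 - α := by linarith
      subst hβ'
      -- Two values at most `p.2` with a strict convex combination equal to `p.2` both equal `p.2`.
      have h4 : intFunctional p.1 x = p.2 := by nlinarith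
      have h5 : intFunctional p.1 y = p.2 := by nlinarith
      rw [h4, h5, sub_self])
  exact ⟨u, hu, fun p hp h => hu' p (Finset.mem_filter.2 ⟨hp, h⟩)⟩

/-- For `v` in `P`, the active inequalities share an integer period and the signs of the others are
fixed by `v`. For `v` outside `P`, a violated inequality stays violated throughout the germ, so the
series itself is zero. -/
lemma hasRationalFunction_germSeries_of_notMem_vertices (hs : P.carrier = solutionSet s)
    (φ : P.Face → R) {v : Fin n → ℝ} (hv : v ∉ P.vertices) :
    HasRationalFunction
      (germSeries (fun p : s => p.1.1) (fun p => p.1.2) v (P.patternWeight s φ)) 0 := by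
  classical
  by_cases hvP : v ∈ P.carrier
  · obtain ⟨u, hu, hu'⟩ := exists_int_dotProduct_eq_zero_of_notMem_vertices hs hvP hv
    refine .zero_of_periodic hu fun c => ?_
    simp only [germSeries, patternSeries]
    congr 1
    funext p
    simp only [signComp]
    split_ifs with h
    · exact signPattern_sub_intCast (hu' p p.2 (signPattern_eq_zero_iff.1 h)) c
    · rfl
  · convert hasRationalFunction_zero using 1
    funext c
    obtain ⟨y, hy⟩ := exists_signPattern_eq_signComp (a := fun p : s => p.1.1)
      (b := fun p => p.1.2) v fun k => (c k : ℝ)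
    simp only [germSeries, patternSeries]
    rw [← hy, patternWeight_signPattern hs, dif_neg, Pi.zero_apply]
    rw [hs, mem_solutionSet_iff_signPattern] at hvP ⊢
    push Not at hvP ⊢
    obtain ⟨p, hp⟩ := hvP
    refine ⟨p, ?_⟩
    rw [hy, signComp, hp, if_neg one_ne_zero]

end RationalPolyhedron

theorem theorem4 {n : ℕ} {R : Type*} [CommRing R] (P : RationalPolyhedron n) (φ : P.Face → R) :
    IsRationalSeries (P.weightedSeries φ) ∧
    (∀ v : P.vertices, IsRationalSeries
      ((P.tangentCone v v.2.1).weightedSeries fun F => φ F.ofTangentCone)) ∧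
    P.weightedIPT φ =
      ∑ v : P.vertices, (P.tangentCone v v.2.1).weightedIPT fun F => φ F.ofTangentCone := by
  classical
  obtain ⟨s, hs⟩ := P.exists_eq
  obtain ⟨q, hq, hsum⟩ := isBrion (fun p : s => p.1.1) (fun p => p.1.2) (P.patternWeight s φ)
  rw [RationalPolyhedron.patternSeries_patternWeight hs] at hsum
  have hvert : ∀ v : P.vertices, HasRationalFunction
      ((P.tangentCone v v.2.1).weightedSeries fun F => φ F.ofTangentCone) (q v) := by
    intro v
    rw [← RationalPolyhedron.germSeries_patternWeight hs]
    exact hq v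
  refine ⟨hsum.isRationalSeries, fun v => (hvert v).isRationalSeries, ?_⟩
  -- Uniqueness of the represented rational function forces `q` to vanish off the vertices.
  have hsub : q.support ⊆ P.vertices.toFinset := by
    intro v hv
    rw [Set.mem_toFinset]
    by_contra h
    exact Finsupp.mem_support_iff.1 hv ((hq v).unique
      (RationalPolyhedron.hasRationalFunction_germSeries_of_notMem_vertices hs φ h))
  rw [RationalPolyhedron.weightedIPT, hsum.rationalFunction_eq,
    Finsupp.sum_of_support_subset _ hsub _ fun _ _ => rfl, ← Finset.sum_set_coe]
  exact Finset.sum_congr rfl fun v _ => (hvert v).rationalFunction_eq.symm
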